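/- Let $k\in\mathbb N$, $k\ge 1$, and let $A\in\mathbb R^{k\times k}$ be symmetric and positive definite. Let $N=N(n)$ be a strictly increasing sequence of natural numbers and, for each $n$, let $B^{(n)}_1,\dots,B^{(n)}_k$ be a partition of $\{1,\dots,N\}$ into $k$ blocks such that the limits $\gamma_i=\lim_{n\to\infty}\sqrt{|B^{(n)}_i|/N}$ exist and satisfy $\gamma_i>0$ for $i=1,\dots,k$. Put $\Gamma_\infty=\operatorname{diag}(\gamma_1,\dots,\gamma_k)$. Let $J_n\in\mathbb R^{N\times N}$ be the matrix with $(J_n)_{ij}=A_{pq}/N$ for $i\in B^{(n)}_p$, $j\in B^{(n)}_q$, and let $\mu_{J_n}$ be the probability measure on $\{-1,+1\}^N$ with $$\mu_{J_n}(x)=Z_n^{-1}\exp\Big(\tfrac12\sum_{i,j=1}^N (J_n)_{ij}x_ix_j\Big),$$ where $Z_n$ is the normalizing constant. Let $\tilde m^{(n)}(x)=\big(|B^{(n)}_i|^{-1}\sum_{j\in B^{(n)}_i}x_j\big)_{i=1,\dots,k}$ be the normalized block magnetization vector (a component belonging to an empty block is $0$), let $\|\cdot\|$ be the Euclidean norm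 on $\mathbb R^k$, and let $\|\cdot\|_{2\to2}$ be the corresponding operator norm. Assume $\|\Gamma_\infty A\Gamma_\infty\|_{2\to2}\le 1$. Then $\tilde m^{(n)}$ converges to $0$ exponentially fast in $\mu_{J_n}$-probability: for every $\varepsilon>0$ there is a constant $I_\varepsilon>0$ such that for all sufficiently large $n$ $$\mu_{J_n}\big(\|\tilde m^{(n)}\|\ge\varepsilon\big)\le\exp(-N I_\varepsilon).$$ Moreover, let $L^*(t)=\frac12(1+t)\log(1+t)+\frac12(1-t)\log(1-t)$ for $t\in[-1,1]$ (with $0\log 0=0$), and for $x\in[-1,1]^k$ let $$I(x)=\tfrac12\langle x,\Gamma_\infty^2A\Gamma_\infty^2x\rangle-\sum_{i=1}^k\gamma_i^2L^*(x_i),\qquad J(x)=\sup_{y\in[-1,1]^k}I(y)-I(x).$$ Then $0$ is the unique critical point (zero of $\nabla J$) and the unique local extremum of the rate function $J$ in the open cube $(-1,1)^k$; it is the unique local minimum of $J$ on the closed cube $[-1,1]^k$; and $J(0)=0$, while $J(x)>0$ for every $x\in[-1,1]^k\setminus\{0\}$. -/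

import Mathlib

namespace BlockIsing

noncomputable section

open Matrix

/-- Spin configurations `{-1, +1}^N`; the group `ℤˣ` of units of `ℤ` is `{1, -1}`. -/
abbrev Config (N : ℕ) : Type := Fin N → ℤˣ

/-- The spin at site `j` as a real number. -/
def spin {N : ℕ} (x : Config N) (j : Fin N) : ℝ := ((x j : ℤ) : ℝ)

/-- A partition of the `N` sites into blocks labelled by `Fin k` is given by the function `b`
assigning to each site the label of its block. This is the block with label `i`. -/
def block {N k : ℕ} (b : Fin N → Fin k) (i : Fin k) : Finset (Fin N) :=
  Finset.univ.filter fun j => b j = i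

/-- The interaction matrix: the entry at a pair of sites in blocks `p`, `q` is `A p q / N`. -/
def interaction {N k : ℕ} (A : Matrix (Fin k) (Fin k) ℝ) (b : Fin N → Fin k) :
    Matrix (Fin N) (Fin N) ℝ :=
  Matrix.of fun i j => A (b i) (b j) / (N : ℝ)

/-- The Hamiltonian `H(x) = (1/2) ∑ i j, J i j * x i * x j` (sign convention: weight `exp H`). -/
def hamiltonian {N : ℕ} (J : Matrix (Fin N) (Fin N) ℝ) (x : Config N) : ℝ :=
  (1 / 2) * ∑ i, ∑ j, J i j * spin x i * spin x j

/-- The partition function. -/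
def partitionFn {N : ℕ} (J : Matrix (Fin N) (Fin N) ℝ) : ℝ :=
  ∑ x : Config N, Real.exp (hamiltonian J x)

theorem partitionFn_pos {N : ℕ} (J : Matrix (Fin N) (Fin N) ℝ) : 0 < partitionFn J :=
  Finset.sum_pos (fun _ _ => Real.exp_pos _) Finset.univ_nonempty

/-- The Ising model `μ_J` with interaction matrix `J`. -/
def ising {N : ℕ} (J : Matrix (Fin N) (Fin N) ℝ) : PMF (Config N) :=
  PMF.ofFintype (fun x => ENNReal.ofReal (Real.exp (hamiltonian J x) / partitionFn J)) <| by
    rw [← ENNReal.ofReal_sum_of_nonneg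
      (fun x _ => div_nonneg (Real.exp_pos _).le (partitionFn_pos J).le), ← Finset.sum_div]
    exact (congrArg ENNReal.ofReal (div_self (partitionFn_pos J).ne')).trans ENNReal.ofReal_one

/-- The normalized block magnetization vector, in Euclidean `k`-space. -/
def magnetization {N k : ℕ} (b : Fin N → Fin k) (x : Config N) : EuclideanSpace ℝ (Fin k) :=
  WithLp.toLp 2 fun i => (∑ j ∈ block b i, spin x j) / ((block b i).card : ℝ)

/-- The convex conjugate of `log cosh` on its effective domain `[-1, 1]`
(only the values there are used). -/
def Lstar (t : ℝ) : ℝ :=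
  (1 / 2) * (1 + t) * Real.log (1 + t) + (1 / 2) * (1 - t) * Real.log (1 - t)

/-- The closed cube `[-1, 1]^k`. -/
def cube (k : ℕ) : Set (EuclideanSpace ℝ (Fin k)) := {x | ∀ i, x i ∈ Set.Icc (-1 : ℝ) 1}

/-- The open cube `(-1, 1)^k`. -/
def openCube (k : ℕ) : Set (EuclideanSpace ℝ (Fin k)) := {x | ∀ i, x i ∈ Set.Ioo (-1 : ℝ) 1}

/-- The functional `I(x) = (1/2) ⟨x, Γ² A Γ² x⟩ - ∑ i, γ i ^ 2 * L*(x i)` with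
`Γ = diag γ`, for `x` in the closed cube (outside the cube it is `-∞` by convention). -/
def functional {k : ℕ} (A : Matrix (Fin k) (Fin k) ℝ) (γ : Fin k → ℝ)
    (x : EuclideanSpace ℝ (Fin k)) : ℝ :=
  (1 / 2) * ((x : Fin k → ℝ) ⬝ᵥ ((diagonal γ ^ 2 * A * diagonal γ ^ 2) *ᵥ (x : Fin k → ℝ)))
    - ∑ i, γ i ^ 2 * Lstar (x i)

/-- The large deviation rate function `sup I - I(x)`, for `x` in the closed cube (outside the
cube it is `+∞` by convention, so the supremum is the one over the cube). -/
def rate {k : ℕ} (A : Matrix (Fin k) (Fin k) ℝ) (γ : Fin k → ℝ)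
    (x : EuclideanSpace ℝ (Fin k)) : ℝ :=
  sSup (functional A γ '' cube k) - functional A γ x

end

end BlockIsing

namespace BlockIsing

open Filter Topology

/-! `L*` exceeds `t²/2 + t⁴/12` by a convex even function vanishing at `0`. The norm condition
bounds the quadratic part of `I` by `½ ∑ γᵢ² xᵢ²`, which the terms `t²/2` absorb; even at norm
exactly `1` the quartic terms leave `I(x) ≤ -∑ γᵢ² xᵢ⁴ / 12` (`functional_le`). Hence `sup I = 0`,
attained only at `0`. The same splitting gives `J(s x) ≤ s J(x)` for `s ∈ [0,1]` (`rate_smul_le`),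
so `J` is strictly monotone along rays, which rules out every other critical point and extremum.

Concentration is a method-of-types bound (`ising_real_le`). Under independent spins whose means are
the block magnetizations of `x` itself, `x` has probability `exp(∑ |B_p| L*(m_p)) / 2^N`. Since `Z ≥
2^N` and there are at most `(N+1)^k` magnetization vectors, an event has mass at most `(N+1)^k`
times the exponential of the largest value of `H - ∑ |B_p| L*(m_p)` on it, which is asymptotically
`N · I(m)`. -/

/-! ### Convexity and growth of `L*`. -/

theorem continuous_Lstar : Continuous Lstar := by
  have h1 : Continuous fun t : ℝ => (1 + t) * Real.log (1 + t) :=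
    Real.continuous_mul_log.comp (by fun_prop : Continuous fun t : ℝ => 1 + t)
  have h2 : Continuous fun t : ℝ => (1 - t) * Real.log (1 - t) :=
    Real.continuous_mul_log.comp (by fun_prop : Continuous fun t : ℝ => 1 - t)
  have : Lstar = fun t : ℝ => (1 / 2) * ((1 + t) * Real.log (1 + t))
      + (1 / 2) * ((1 - t) * Real.log (1 - t)) := by
    funext t; simp only [Lstar]; ring
  rw [this]
  fun_prop

theorem hasDerivAt_Lstar {t : ℝ} (ht : t ∈ Set.Ioo (-1 : ℝ) 1) :
    HasDerivAt Lstar ((1 / 2) * (Real.log (1 + t) - Real.log (1 - t))) t := by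
  have h1 : (1 + t) ≠ 0 := by linarith [ht.1]
  have h2 : (1 - t) ≠ 0 := by linarith [ht.2]
  have a : HasDerivAt (fun t : ℝ => 1 + t) 1 t := (hasDerivAt_id t).const_add 1
  have c : HasDerivAt (fun t : ℝ => 1 - t) (-1) t := (hasDerivAt_id t).const_sub 1
  have := ((a.const_mul (1 / 2)).mul (a.log h1)).add ((c.const_mul (1 / 2)).mul (c.log h2))
  refine (this.congr_deriv ?_).congr_of_eventuallyEq (Eventually.of_forall fun s => ?_)
  · field_simp
    ring
  · simp [Lstar]

theorem Lstar_zero : Lstar 0 = 0 := by simp [Lstar]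

theorem Lstar_neg (t : ℝ) : Lstar (-t) = Lstar t := by
  simp only [Lstar, sub_neg_eq_add, ← sub_eq_add_neg]; ring

theorem Lstar_le_one {t : ℝ} (ht : t ∈ Set.Icc (-1 : ℝ) 1) : Lstar t ≤ 1 := by
  have key : ∀ s : ℝ, 0 ≤ s → s ≤ 2 → s * Real.log s ≤ s := by
    intro s h0 h2
    rcases h0.eq_or_lt with rfl | hs
    · simp
    · have : Real.log s ≤ 1 := by linarith [Real.log_le_sub_one_of_pos hs]
      nlinarith
  have h1 := key (1 + t) (by linarith [ht.1]) (by linarith [ht.2])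
  have h2 := key (1 - t) (by linarith [ht.2]) (by linarith [ht.1])
  simp only [Lstar]
  linarith

/-- `L*` minus its fourth order Taylor polynomial at `0` is convex. -/
theorem convexOn_Lstar_sub :
    ConvexOn ℝ (Set.Icc (-1 : ℝ) 1) fun t => Lstar t - (t ^ 2 / 2 + t ^ 4 / 12) := by
  have hd : ∀ t ∈ Set.Ioo (-1 : ℝ) 1, HasDerivAt (fun t => Lstar t - (t ^ 2 / 2 + t ^ 4 / 12))
      ((1 / 2) * (Real.log (1 + t) - Real.log (1 - t)) - (t + t ^ 3 / 3)) t := by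
    intro t ht
    refine ((hasDerivAt_Lstar ht).sub (((hasDerivAt_pow 2 t).div_const 2).add
      ((hasDerivAt_pow 4 t).div_const 12))).congr_deriv ?_
    norm_num
    ring
  -- Here `L*'' = 1/(1 - t²)`, and subtracting `1 + t²` leaves `t⁴/(1 - t²) ≥ 0`.
  have hd2 : ∀ t ∈ Set.Ioo (-1 : ℝ) 1,
      HasDerivAt (fun t => (1 / 2) * (Real.log (1 + t) - Real.log (1 - t)) - (t + t ^ 3 / 3))
        (t ^ 4 / (1 - t ^ 2)) t := by
    intro t ht
    have h1 : (1 + t) ≠ 0 := by linarith [ht.1]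
    have h2 : (1 - t) ≠ 0 := by linarith [ht.2]
    have h3 : (1 - t ^ 2) ≠ 0 := by
      rw [show 1 - t ^ 2 = (1 + t) * (1 - t) by ring]; exact mul_ne_zero h1 h2
    have a : HasDerivAt (fun t : ℝ => 1 + t) 1 t := (hasDerivAt_id t).const_add 1
    have c : HasDerivAt (fun t : ℝ => 1 - t) (-1) t := (hasDerivAt_id t).const_sub 1
    refine ((((a.log h1).sub (c.log h2)).const_mul (1 / 2)).sub
      ((hasDerivAt_id t).add ((hasDerivAt_pow 3 t).div_const 3))).congr_deriv ?_
    rw [show 1 - t ^ 2 = (1 + t) * (1 - t) by ring]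
    field_simp
    norm_num
    ring
  refine convexOn_of_hasDerivWithinAt2_nonneg (convex_Icc _ _)
    (continuous_Lstar.sub (by fun_prop)).continuousOn
    (f' := fun t => (1 / 2) * (Real.log (1 + t) - Real.log (1 - t)) - (t + t ^ 3 / 3))
    (f'' := fun t => t ^ 4 / (1 - t ^ 2)) ?_ ?_ ?_ <;> rw [interior_Icc]
  · exact fun t ht => (hd t ht).hasDerivWithinAt
  · exact fun t ht => (hd2 t ht).hasDerivWithinAt
  · intro t ht
    have : 0 ≤ 1 - t ^ 2 := by nlinarith [ht.1, ht.2]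
    positivity

/-- Midpoint convexity of the even remainder at `t` and `-t`, compared with its value `0` at the
origin. -/
theorem Lstar_ge {t : ℝ} (ht : t ∈ Set.Icc (-1 : ℝ) 1) : t ^ 2 / 2 + t ^ 4 / 12 ≤ Lstar t := by
  have hn : -t ∈ Set.Icc (-1 : ℝ) 1 := ⟨by linarith [ht.2], by linarith [ht.1]⟩
  have := convexOn_Lstar_sub.2 ht hn (by norm_num : (0 : ℝ) ≤ 1 / 2)
    (by norm_num : (0 : ℝ) ≤ 1 / 2) (by norm_num)
  simp only [smul_eq_mul, Lstar_neg] at this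
  rw [show 1 / 2 * t + 1 / 2 * -t = 0 by ring, Lstar_zero] at this
  nlinarith [this]

theorem Lstar_nonneg {t : ℝ} (ht : t ∈ Set.Icc (-1 : ℝ) 1) : 0 ≤ Lstar t :=
  le_trans (by positivity) (Lstar_ge ht)

/-- Convexity between `0` and `t` handles the remainder, and `s⁴ ≤ s` the quartic term. -/
theorem Lstar_smul_sub_le {s t : ℝ} (hs : s ∈ Set.Icc (0 : ℝ) 1) (ht : t ∈ Set.Icc (-1 : ℝ) 1) :
    Lstar (s * t) - (s * t) ^ 2 / 2 ≤ s * (Lstar t - t ^ 2 / 2) := by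
  have h0 : (0 : ℝ) ∈ Set.Icc (-1 : ℝ) 1 := by constructor <;> norm_num
  have := convexOn_Lstar_sub.2 ht h0 hs.1 (sub_nonneg.2 hs.2) (by ring)
  simp only [smul_eq_mul, mul_zero, add_zero, Lstar_zero] at this
  have h4 : s ^ 4 ≤ s := by
    simpa using pow_le_pow_of_le_one hs.1 hs.2 (show 1 ≤ 4 by norm_num)
  have : (s * t) ^ 4 ≤ s * t ^ 4 := by
    rw [mul_pow]; exact mul_le_mul_of_nonneg_right h4 (by positivity)
  norm_num at *
  nlinarith

/-! ### The rate function and its critical points. -/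

section Functional

variable {k : ℕ} {A : Matrix (Fin k) (Fin k) ℝ} {γ : Fin k → ℝ}

theorem functional_eq (x : EuclideanSpace ℝ (Fin k)) :
    functional A γ x = (1 / 2) * ∑ p, ∑ q, A p q * (γ p ^ 2 * γ q ^ 2) * (x p * x q)
      - ∑ i, γ i ^ 2 * Lstar (x i) := by
  simp only [functional, Matrix.diagonal_pow, dotProduct, Matrix.mulVec, Matrix.mul_diagonal,
    Matrix.diagonal_mul, Finset.mul_sum, Pi.pow_apply]
  congr 1
  refine Finset.sum_congr rfl fun p _ => Finset.sum_congr rfl fun q _ => ?_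
  ring

/-- Cauchy–Schwarz for `⟨y, Γ A Γ y⟩` with `y = Γ x`. -/
theorem quadratic_le (hhigh : ‖Matrix.toEuclideanCLM (n := Fin k) (𝕜 := ℝ)
      (Matrix.diagonal γ * A * Matrix.diagonal γ)‖ ≤ 1) (x : Fin k → ℝ) :
    ∑ p, ∑ q, A p q * (γ p ^ 2 * γ q ^ 2) * (x p * x q) ≤ ∑ p, γ p ^ 2 * x p ^ 2 := by
  set y : EuclideanSpace ℝ (Fin k) := WithLp.toLp 2 fun i => γ i * x i with hy
  set T := Matrix.toEuclideanCLM (n := Fin k) (𝕜 := ℝ)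
      (Matrix.diagonal γ * A * Matrix.diagonal γ) with hT
  have h1 : inner ℝ y (T y) ≤ ‖y‖ ^ 2 := by
    calc inner ℝ y (T y) ≤ ‖y‖ * ‖T y‖ := real_inner_le_norm _ _
      _ ≤ ‖y‖ * (1 * ‖y‖) := by
        gcongr
        exact T.le_of_opNorm_le hhigh y
      _ = ‖y‖ ^ 2 := by ring
  have h2 : inner ℝ y (T y) = ∑ p, ∑ q, A p q * (γ p ^ 2 * γ q ^ 2) * (x p * x q) := by
    simp only [PiLp.inner_apply, hT, hy, Matrix.toEuclideanCLM_toLp, Matrix.mulVec, dotProduct,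
      Matrix.mul_diagonal, Matrix.diagonal_mul, RCLike.inner_apply, conj_trivial, Finset.sum_mul]
    refine Finset.sum_congr rfl fun p _ => Finset.sum_congr rfl fun q _ => ?_
    ring
  have h3 : ‖y‖ ^ 2 = ∑ p, γ p ^ 2 * x p ^ 2 := by
    simp [EuclideanSpace.norm_sq_eq, hy, mul_pow]
  linarith

theorem functional_le (hhigh : ‖Matrix.toEuclideanCLM (n := Fin k) (𝕜 := ℝ)
      (Matrix.diagonal γ * A * Matrix.diagonal γ)‖ ≤ 1)
    {x : EuclideanSpace ℝ (Fin k)} (hx : x ∈ cube k) :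
    functional A γ x ≤ -∑ i, γ i ^ 2 * (x i ^ 4 / 12) := by
  rw [functional_eq]
  have h1 := quadratic_le hhigh x
  have h2 : ∑ i, γ i ^ 2 * (x i ^ 2 / 2 + x i ^ 4 / 12) ≤ ∑ i, γ i ^ 2 * Lstar (x i) :=
    Finset.sum_le_sum fun i _ => mul_le_mul_of_nonneg_left (Lstar_ge (hx i)) (sq_nonneg _)
  have h3 : ∑ i, γ i ^ 2 * (x i ^ 2 / 2 + x i ^ 4 / 12)
      = (1 / 2) * (∑ p, γ p ^ 2 * x p ^ 2) + ∑ i, γ i ^ 2 * (x i ^ 4 / 12) := by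
    rw [Finset.mul_sum, ← Finset.sum_add_distrib]
    exact Finset.sum_congr rfl fun i _ => by ring
  linarith

theorem functional_zero : functional A γ 0 = 0 := by
  simp [functional_eq, Lstar_zero]

theorem zero_mem_openCube : (0 : EuclideanSpace ℝ (Fin k)) ∈ openCube k := fun i => by simp

theorem openCube_subset_cube : openCube k ⊆ cube k := fun _ hx i => Set.Ioo_subset_Icc_self (hx i)

theorem isOpen_openCube : IsOpen (openCube k) := by
  have : openCube k = ⋂ i, (fun x : EuclideanSpace ℝ (Fin k) => x i) ⁻¹' Set.Ioo (-1) 1 := by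
    ext x; simp [openCube]
  rw [this]
  exact isOpen_iInter_of_finite fun i => isOpen_Ioo.preimage (by fun_prop)

theorem smul_mem_cube {x : EuclideanSpace ℝ (Fin k)} (hx : x ∈ cube k) {s : ℝ}
    (hs : s ∈ Set.Icc (0 : ℝ) 1) : s • x ∈ cube k := fun i => by
  have := hx i
  simp only [PiLp.smul_apply, smul_eq_mul, Set.mem_Icc] at *
  constructor <;> nlinarith

theorem sSup_functional (hhigh : ‖Matrix.toEuclideanCLM (n := Fin k) (𝕜 := ℝ)
      (Matrix.diagonal γ * A * Matrix.diagonal γ)‖ ≤ 1) :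
    sSup (functional A γ '' cube k) = 0 := by
  refine IsGreatest.csSup_eq ⟨⟨0, openCube_subset_cube zero_mem_openCube, functional_zero⟩, ?_⟩
  rintro _ ⟨x, hx, rfl⟩
  exact (functional_le hhigh hx).trans (neg_nonpos.2 (Finset.sum_nonneg fun i _ => by positivity))

theorem rate_eq (hhigh : ‖Matrix.toEuclideanCLM (n := Fin k) (𝕜 := ℝ)
      (Matrix.diagonal γ * A * Matrix.diagonal γ)‖ ≤ 1) :
    rate A γ = fun x => -functional A γ x := by
  funext x; rw [rate, sSup_functional hhigh, zero_sub]

theorem rate_pos (hγ : ∀ i, 0 < γ i) (hhigh : ‖Matrix.toEuclideanCLM (n := Fin k) (𝕜 := ℝ)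
      (Matrix.diagonal γ * A * Matrix.diagonal γ)‖ ≤ 1)
    {x : EuclideanSpace ℝ (Fin k)} (hx : x ∈ cube k) (h0 : x ≠ 0) : 0 < rate A γ x := by
  rw [rate_eq hhigh]
  have h1 := functional_le hhigh hx
  obtain ⟨i, hi⟩ : ∃ i, x i ≠ 0 := by
    by_contra! h
    exact h0 (PiLp.ext h)
  have h2 : 0 < ∑ i, γ i ^ 2 * (x i ^ 4 / 12) := by
    refine Finset.sum_pos' (fun i _ => by positivity) ⟨i, Finset.mem_univ _, ?_⟩
    have := hγ i
    positivity
  simp only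
  linarith

theorem rate_zero (hhigh : ‖Matrix.toEuclideanCLM (n := Fin k) (𝕜 := ℝ)
      (Matrix.diagonal γ * A * Matrix.diagonal γ)‖ ≤ 1) : rate A γ 0 = 0 := by
  simp [rate_eq hhigh, functional_zero]

/-- The rate function is star-convex at its zero. -/
theorem rate_smul_le (hhigh : ‖Matrix.toEuclideanCLM (n := Fin k) (𝕜 := ℝ)
      (Matrix.diagonal γ * A * Matrix.diagonal γ)‖ ≤ 1)
    {x : EuclideanSpace ℝ (Fin k)} (hx : x ∈ cube k) {s : ℝ} (hs : s ∈ Set.Icc (0 : ℝ) 1) :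
    rate A γ (s • x) ≤ s * rate A γ x := by
  simp only [rate_eq hhigh, functional_eq, PiLp.smul_apply, smul_eq_mul]
  have hq := quadratic_le hhigh x
  have hsq : ∑ p, ∑ q, A p q * (γ p ^ 2 * γ q ^ 2) * (s * x p * (s * x q))
      = s ^ 2 * ∑ p, ∑ q, A p q * (γ p ^ 2 * γ q ^ 2) * (x p * x q) := by
    simp only [Finset.mul_sum]
    exact Finset.sum_congr rfl fun p _ => Finset.sum_congr rfl fun q _ => by ring
  have hL : ∑ i, γ i ^ 2 * (Lstar (s * x i) - (s * x i) ^ 2 / 2)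
      ≤ ∑ i, γ i ^ 2 * (s * (Lstar (x i) - x i ^ 2 / 2)) :=
    Finset.sum_le_sum fun i _ =>
      mul_le_mul_of_nonneg_left (Lstar_smul_sub_le hs (hx i)) (sq_nonneg _)
  have e1 : ∑ i, γ i ^ 2 * (Lstar (s * x i) - (s * x i) ^ 2 / 2)
      = ∑ i, γ i ^ 2 * Lstar (s * x i) - s ^ 2 / 2 * ∑ i, γ i ^ 2 * x i ^ 2 := by
    rw [Finset.mul_sum, ← Finset.sum_sub_distrib]
    exact Finset.sum_congr rfl fun i _ => by ring
  have e2 : ∑ i, γ i ^ 2 * (s * (Lstar (x i) - x i ^ 2 / 2))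
      = s * ∑ i, γ i ^ 2 * Lstar (x i) - s / 2 * ∑ i, γ i ^ 2 * x i ^ 2 := by
    rw [Finset.mul_sum, Finset.mul_sum, ← Finset.sum_sub_distrib]
    exact Finset.sum_congr rfl fun i _ => by ring
  rw [hsq]
  have hs2 : s ^ 2 ≤ s := by nlinarith [hs.1, hs.2]
  -- `J` is the sum of `γᵢ² (L*(xᵢ) - xᵢ²/2)` plus half the nonnegative gap in `quadratic_le`; the
  -- gap scales by `s² ≤ s`.
  nlinarith [mul_nonneg (sub_nonneg.2 hs2) (sub_nonneg.2 hq)]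

theorem isMinOn_rate_zero (hγ : ∀ i, 0 < γ i)
    (hhigh : ‖Matrix.toEuclideanCLM (n := Fin k) (𝕜 := ℝ)
      (Matrix.diagonal γ * A * Matrix.diagonal γ)‖ ≤ 1) : IsMinOn (rate A γ) (cube k) 0 := by
  intro x hx
  change rate A γ 0 ≤ rate A γ x
  rw [rate_zero hhigh]
  rcases eq_or_ne x 0 with rfl | h0
  · exact (rate_zero hhigh).ge
  · exact (rate_pos hγ hhigh hx h0).le

theorem isLocalMin_rate_zero (hγ : ∀ i, 0 < γ i)
    (hhigh : ‖Matrix.toEuclideanCLM (n := Fin k) (𝕜 := ℝ)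
      (Matrix.diagonal γ * A * Matrix.diagonal γ)‖ ≤ 1) : IsLocalMin (rate A γ) 0 :=
  (isMinOn_rate_zero hγ hhigh).isLocalMin
    (mem_of_superset (isOpen_openCube.mem_nhds zero_mem_openCube) openCube_subset_cube)

theorem isLocalMinOn_rate_iff (hγ : ∀ i, 0 < γ i)
    (hhigh : ‖Matrix.toEuclideanCLM (n := Fin k) (𝕜 := ℝ)
      (Matrix.diagonal γ * A * Matrix.diagonal γ)‖ ≤ 1)
    {x : EuclideanSpace ℝ (Fin k)} (hx : x ∈ cube k) :
    IsLocalMinOn (rate A γ) (cube k) x ↔ x = 0 := by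
  refine ⟨fun h => ?_, ?_⟩
  · by_contra h0
    have hpos := rate_pos hγ hhigh hx h0
    -- Shrinking `x` towards `0` stays in the cube and strictly lowers `J`.
    have ht : Tendsto (fun s : ℝ => s • x) (𝓝[<] 1) (𝓝[cube k] x) := by
      refine tendsto_nhdsWithin_iff.2 ⟨?_, ?_⟩
      · have : Continuous fun s : ℝ => s • x := by fun_prop
        simpa using (this.tendsto 1).mono_left nhdsWithin_le_nhds
      · filter_upwards [Ioo_mem_nhdsLT (zero_lt_one (α := ℝ))] with s hs
        exact smul_mem_cube hx ⟨hs.1.le, hs.2.le⟩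
    obtain ⟨s, hs, hs'⟩ := ((ht.eventually h).and (Ioo_mem_nhdsLT (zero_lt_one (α := ℝ)))).exists
    have := rate_smul_le (A := A) hhigh hx ⟨hs'.1.le, hs'.2.le⟩
    nlinarith [hs'.2]
  · rintro rfl
    exact (isMinOn_rate_zero hγ hhigh).localize

theorem isLocalExtr_rate_iff (hγ : ∀ i, 0 < γ i)
    (hhigh : ‖Matrix.toEuclideanCLM (n := Fin k) (𝕜 := ℝ)
      (Matrix.diagonal γ * A * Matrix.diagonal γ)‖ ≤ 1)
    {x : EuclideanSpace ℝ (Fin k)} (hx : x ∈ openCube k) :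
    IsLocalExtr (rate A γ) x ↔ x = 0 := by
  refine ⟨fun h => h.elim (fun h => ?_) fun h => ?_, ?_⟩
  · exact (isLocalMinOn_rate_iff hγ hhigh (openCube_subset_cube hx)).1 (h.on _)
  · by_contra h0
    have hpos := rate_pos hγ hhigh (openCube_subset_cube hx) h0
    -- Pushing `x` outwards, possible in the open cube, gives `J(s x) ≥ s J(x) > J(x)`, so `x` is no
    -- local maximum.
    have ht : Tendsto (fun s : ℝ => s • x) (𝓝[>] 1) (𝓝 x) := by
      have : Continuous fun s : ℝ => s • x := by fun_prop
      simpa using (this.tendsto 1).mono_left nhdsWithin_le_nhds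
    obtain ⟨s, ⟨hs, hc⟩, hs1⟩ := (((ht.eventually h).and
      (ht.eventually (isOpen_openCube.mem_nhds hx))).and self_mem_nhdsWithin).exists
    have hs1 : 1 < s := hs1
    have h1 := rate_smul_le (A := A) hhigh (openCube_subset_cube hc)
      (s := s⁻¹) ⟨by positivity, inv_le_one_of_one_le₀ hs1.le⟩
    rw [smul_smul, inv_mul_cancel₀ (by positivity), one_smul, inv_mul_eq_div,
      le_div_iff₀ (by positivity)] at h1
    nlinarith
  · rintro rfl
    exact Or.inl (isLocalMin_rate_zero hγ hhigh)

theorem differentiableAt_functional {x : EuclideanSpace ℝ (Fin k)} (hx : x ∈ openCube k) :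
    DifferentiableAt ℝ (functional A γ) x := by
  have : functional A γ = fun x : EuclideanSpace ℝ (Fin k) =>
      (1 / 2) * ∑ p, ∑ q, A p q * (γ p ^ 2 * γ q ^ 2) * (x p * x q)
      - ∑ i, γ i ^ 2 * Lstar (x i) := funext functional_eq
  rw [this]
  refine DifferentiableAt.sub (by fun_prop) (DifferentiableAt.fun_sum fun i _ => ?_)
  refine DifferentiableAt.const_mul ?_ _
  exact (hasDerivAt_Lstar (hx i)).differentiableAt.comp x
    (by fun_prop : DifferentiableAt ℝ (fun x : EuclideanSpace ℝ (Fin k) => x i) x)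

theorem hasGradientAt_rate_iff (hγ : ∀ i, 0 < γ i)
    (hhigh : ‖Matrix.toEuclideanCLM (n := Fin k) (𝕜 := ℝ)
      (Matrix.diagonal γ * A * Matrix.diagonal γ)‖ ≤ 1)
    {x : EuclideanSpace ℝ (Fin k)} (hx : x ∈ openCube k) :
    HasGradientAt (rate A γ) 0 x ↔ x = 0 := by
  refine ⟨fun h => ?_, ?_⟩
  · by_contra h0
    have hpos := rate_pos hγ hhigh (openCube_subset_cube hx) h0
    have hf : HasFDerivAt (rate A γ) (0 : EuclideanSpace ℝ (Fin k) →L[ℝ] ℝ) x := by simpa using h.hasFDerivAt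
    have hl : HasDerivAt (fun s : ℝ => rate A γ (s • x)) 0 1 := by
      have hf' : HasFDerivAt (rate A γ) (0 : EuclideanSpace ℝ (Fin k) →L[ℝ] ℝ) ((1 : ℝ) • x) := by simpa using hf
      exact (hf'.comp_hasDerivAt (1 : ℝ) ((hasDerivAt_id (1 : ℝ)).smul_const x)).congr_deriv rfl
    -- Left slopes of `s ↦ J(s x)` at `1` are at least `J(x) > 0`, contradicting a zero derivative.
    have hslope := (hasDerivAt_iff_tendsto_slope.1 hl).mono_left
      (nhdsWithin_mono 1 (fun s (hs : s ∈ Set.Iio 1) => (Set.mem_Iio.1 hs).ne))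
    have : rate A γ x ≤ 0 := by
      refine ge_of_tendsto hslope ?_
      filter_upwards [Ioo_mem_nhdsLT (zero_lt_one (α := ℝ))] with s hs
      have h1 := rate_smul_le (A := A) hhigh (openCube_subset_cube hx) ⟨hs.1.le, hs.2.le⟩
      rw [slope_def_field, one_smul, le_div_iff_of_neg (by linarith [hs.2])]
      linarith
    linarith
  · rintro rfl
    have hd : DifferentiableAt ℝ (rate A γ) 0 := by
      rw [rate_eq hhigh]; exact (differentiableAt_functional zero_mem_openCube).neg
    have h2 := (isLocalMin_rate_zero (A := A) hγ hhigh).fderiv_eq_zero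
    have h1 := hd.hasFDerivAt
    rw [h2] at h1
    rw [hasGradientAt_iff_hasFDerivAt]
    simpa using h1

end Functional

/-! ### Finite-volume bound by tilted product measures. -/

section Finite

variable {N k : ℕ} (b : Fin N → Fin k)

theorem spin_eq_one_or (x : Config N) (j : Fin N) : spin x j = 1 ∨ spin x j = -1 := by
  rcases Int.units_eq_one_or (x j) with h | h <;> simp [spin, h]

theorem abs_spin (x : Config N) (j : Fin N) : |spin x j| = 1 := by
  rcases spin_eq_one_or x j with h | h <;> simp [h]

theorem sum_eq_sum_block (f : Fin N → ℝ) : ∑ j, f j = ∑ p, ∑ j ∈ block b p, f j :=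
  (Finset.sum_fiberwise Finset.univ b f).symm

theorem sum_block_spin (x : Config N) (p : Fin k) :
    ∑ j ∈ block b p, spin x j = (block b p).card * magnetization b x p := by
  rcases (block b p).eq_empty_or_nonempty with h | h
  · simp [h]
  · have : ((block b p).card : ℝ) ≠ 0 := by exact_mod_cast h.card_pos.ne'
    simp only [magnetization]
    field_simp

theorem magnetization_mem_cube (x : Config N) : magnetization b x ∈ cube k := by
  intro p
  rw [Set.mem_Icc, ← abs_le]
  simp only [magnetization]
  rw [abs_div, Nat.abs_cast]
  refine div_le_one_of_le₀ ?_ (Nat.cast_nonneg _)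
  refine (Finset.abs_sum_le_sum_abs _ _).trans ?_
  simp [abs_spin]

theorem hamiltonian_interaction (A : Matrix (Fin k) (Fin k) ℝ) (x : Config N) :
    hamiltonian (interaction A b) x = (1 / 2) * ∑ p, ∑ q, A p q / N *
      ((∑ j ∈ block b p, spin x j) * ∑ j ∈ block b q, spin x j) := by
  rw [hamiltonian, sum_eq_sum_block b]
  congr 1
  refine Finset.sum_congr rfl fun p _ => ?_
  have h : ∀ i ∈ block b p, ∑ j, interaction A b i j * spin x i * spin x j
      = ∑ q, A p q / N * (spin x i * ∑ j ∈ block b q, spin x j) := by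
    intro i hi
    rw [sum_eq_sum_block b]
    refine Finset.sum_congr rfl fun q _ => ?_
    rw [Finset.mul_sum, Finset.mul_sum]
    refine Finset.sum_congr rfl fun j hj => ?_
    have hi : b i = p := by simpa [block] using hi
    have hj : b j = q := by simpa [block] using hj
    simp only [interaction, Matrix.of_apply, hi, hj]
    ring
  rw [Finset.sum_congr rfl h, Finset.sum_comm]
  refine Finset.sum_congr rfl fun q _ => ?_
  rw [Finset.sum_mul, Finset.mul_sum]

theorem hamiltonian_interaction_eq (hN : N ≠ 0) (A : Matrix (Fin k) (Fin k) ℝ) (x : Config N) :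
    hamiltonian (interaction A b) x = N * ((1 / 2) * ∑ p, ∑ q, A p q *
      ((block b p).card / N * ((block b q).card / N)) *
        (magnetization b x p * magnetization b x q)) := by
  have hN : (N : ℝ) ≠ 0 := by exact_mod_cast hN
  rw [hamiltonian_interaction, mul_left_comm, Finset.mul_sum]
  simp only [sum_block_spin, Finset.mul_sum]
  refine Finset.sum_congr rfl fun p _ => Finset.sum_congr rfl fun q _ => ?_
  field_simp

theorem hamiltonian_nonneg {A : Matrix (Fin k) (Fin k) ℝ} (hA : A.PosDef) (x : Config N) :
    0 ≤ hamiltonian (interaction A b) x := by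
  have h := hA.posSemidef.dotProduct_mulVec_nonneg (fun p => ∑ j ∈ block b p, spin x j)
  have e : ∑ p, ∑ q, A p q / N *
      ((∑ j ∈ block b p, spin x j) * ∑ j ∈ block b q, spin x j)
      = (star (fun p => ∑ j ∈ block b p, spin x j) ⬝ᵥ
        (A.mulVec fun p => ∑ j ∈ block b p, spin x j)) / N := by
    simp only [dotProduct, Matrix.mulVec, Pi.star_apply, star_trivial, Finset.sum_div,
      Finset.mul_sum]
    refine Finset.sum_congr rfl fun p _ => Finset.sum_congr rfl fun q _ =>
      Finset.sum_congr rfl fun j _ => ?_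
    ring
  rw [hamiltonian_interaction, e]
  positivity

theorem two_pow_le_partitionFn {A : Matrix (Fin k) (Fin k) ℝ} (hA : A.PosDef) :
    (2 : ℝ) ^ N ≤ partitionFn (interaction A b) := by
  calc (2 : ℝ) ^ N = ∑ _x : Config N, (1 : ℝ) := by simp
    _ ≤ partitionFn (interaction A b) :=
      Finset.sum_le_sum fun x _ => Real.one_le_exp (hamiltonian_nonneg b hA x)

/-- The probability of the configuration `x` under independent spins with means `v (b j)`. -/
noncomputable def tiltedWeight (v : Fin k → ℝ) (x : Config N) : ℝ :=
  ∏ j, (1 + v (b j) * spin x j) / 2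

theorem tiltedWeight_nonneg {v : EuclideanSpace ℝ (Fin k)} (hv : v ∈ cube k) (x : Config N) :
    0 ≤ tiltedWeight b v x := by
  refine Finset.prod_nonneg fun j _ => ?_
  have := hv (b j)
  rcases spin_eq_one_or x j with h | h <;> rw [h] <;> linarith [this.1, this.2]

theorem sum_tiltedWeight (v : Fin k → ℝ) : ∑ x : Config N, tiltedWeight b v x = 1 := by
  have h := Finset.prod_univ_sum (fun _ : Fin N => (Finset.univ : Finset ℤˣ))
    (fun j u => (1 + v (b j) * ((u : ℤ) : ℝ)) / 2)
  rw [Fintype.piFinset_univ] at h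
  simp only [tiltedWeight, spin]
  rw [← h]
  refine Finset.prod_eq_one fun j _ => ?_
  rw [UnitsInt.univ, Finset.sum_pair (by decide)]
  push_cast
  ring

/-- The block average of `1 + xᵢ xⱼ` includes the term `i = j`, equal to `2`. So the logarithms
below are genuine even when a magnetization is `±1`. -/
theorem one_add_magnetization_mul_spin_pos (x : Config N) (j : Fin N) :
    0 < 1 + magnetization b x (b j) * spin x j := by
  have hj : j ∈ block b (b j) := by simp [block]
  have hn : (0 : ℝ) < (block b (b j)).card := by exact_mod_cast Finset.card_pos.2 ⟨j, hj⟩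
  have hs : ∑ i ∈ block b (b j), (1 + spin x i * spin x j)
      = (block b (b j)).card * (1 + magnetization b x (b j) * spin x j) := by
    rw [Finset.sum_add_distrib, ← Finset.sum_mul, sum_block_spin]
    simp
    ring
  have hpos : 0 < ∑ i ∈ block b (b j), (1 + spin x i * spin x j) := by
    refine Finset.sum_pos' (fun i _ => ?_) ⟨j, hj, ?_⟩
    · rcases spin_eq_one_or x i with h | h <;> rcases spin_eq_one_or x j with h' | h' <;>
        rw [h, h'] <;> norm_num
    · rcases spin_eq_one_or x j with h' | h' <;> rw [h'] <;> norm_num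
  rw [hs] at hpos
  exact pos_of_mul_pos_right hpos hn.le

theorem tiltedWeight_magnetization (x : Config N) :
    tiltedWeight b (magnetization b x) x
      = Real.exp (∑ p, (block b p).card * Lstar (magnetization b x p)) / 2 ^ N := by
  rw [tiltedWeight, Finset.prod_div_distrib]
  congr 1
  · rw [← Finset.prod_congr rfl fun j _ =>
      Real.exp_log (one_add_magnetization_mul_spin_pos b x j), ← Real.exp_sum,
      sum_eq_sum_block b]
    congr 1
    refine Finset.sum_congr rfl fun p _ => ?_
    set m := magnetization b x p with hm
    -- Since the spin is `±1`, the logarithm is affine in it, and the block sum sees only `m`.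
    have h : ∀ j ∈ block b p, Real.log (1 + magnetization b x (b j) * spin x j)
        = (1 / 2) * (Real.log (1 + m) + Real.log (1 - m))
          + (1 / 2) * (Real.log (1 + m) - Real.log (1 - m)) * spin x j := by
      intro j hj
      have hj : b j = p := by simpa [block] using hj
      rw [hj, ← hm]
      rcases spin_eq_one_or x j with h | h <;> rw [h]
      · rw [mul_one]; ring
      · rw [mul_neg_one, ← sub_eq_add_neg]; ring
    rw [Finset.sum_congr rfl h, Finset.sum_add_distrib, Finset.sum_const, nsmul_eq_mul,
      ← Finset.mul_sum, sum_block_spin, ← hm, Lstar]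
    ring
  · simp

/-- The number of `+1` spins in each block, a value in `0, …, N`, determines the vector. -/
theorem card_image_magnetization_le [DecidableEq (EuclideanSpace ℝ (Fin k))] :
    (Finset.univ.image (magnetization b)).card ≤ (N + 1) ^ k := by
  let T : Config N → Fin k → Fin (N + 1) := fun x p =>
    ⟨((block b p).filter fun j => x j = 1).card, Nat.lt_succ_of_le <|
      (Finset.card_le_univ _).trans (Fintype.card_fin N).le⟩
  let F : (Fin k → Fin (N + 1)) → EuclideanSpace ℝ (Fin k) := fun a =>
    WithLp.toLp 2 fun p => (2 * ((a p : ℕ) : ℝ) - (block b p).card) / (block b p).card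
  have hF : ∀ x, magnetization b x = F (T x) := by
    intro x
    have hs : ∀ j, spin x j = 2 * (if x j = 1 then 1 else 0) - 1 := by
      intro j
      rcases Int.units_eq_one_or (x j) with h | h
      · simp [spin, h]; norm_num
      · simp [spin, h]
    simp only [magnetization, F, T]
    congr 1
    funext p
    congr 1
    simp only [hs, Finset.sum_sub_distrib, ← Finset.mul_sum, Finset.sum_boole]
    simp
  calc (Finset.univ.image (magnetization b)).card ≤ (Finset.univ.image F).card := by
        refine Finset.card_le_card fun v hv => ?_
        obtain ⟨x, -, rfl⟩ := Finset.mem_image.1 hv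
        exact Finset.mem_image.2 ⟨T x, Finset.mem_univ _, (hF x).symm⟩
    _ ≤ (Finset.univ : Finset (Fin k → Fin (N + 1))).card := Finset.card_image_le
    _ = (N + 1) ^ k := by simp

theorem measurableSingletonClass_intUnits : MeasurableSingletonClass ℤˣ :=
  ⟨fun u => ⟨{(u : ℤ)}, measurableSet_singleton _, by ext v; simp [Units.ext_iff]⟩⟩

theorem ising_real_apply (J : Matrix (Fin N) (Fin N) ℝ) (E : Set (Config N)) :
    (ising J).toMeasure.real E
      = ∑ x, E.indicator (fun x => Real.exp (hamiltonian J x) / partitionFn J) x := by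
  classical
  have := measurableSingletonClass_intUnits
  rw [MeasureTheory.measureReal_def, PMF.toMeasure_apply_fintype, ENNReal.toReal_sum]
  · refine Finset.sum_congr rfl fun x _ => ?_
    by_cases hx : x ∈ E
    · have : 0 ≤ Real.exp (hamiltonian J x) / partitionFn J :=
        div_nonneg (Real.exp_pos _).le (partitionFn_pos J).le
      simp [hx, ising, ENNReal.toReal_ofReal this]
    · simp [hx]
  · intro x _
    by_cases hx : x ∈ E
    · simp [hx, ising]
    · simp [hx]

/-- A union bound over the values of the magnetization vector. -/
theorem ising_real_le {A : Matrix (Fin k) (Fin k) ℝ} (hA : A.PosDef) (E : Set (Config N)) (c : ℝ)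
    (hE : ∀ x ∈ E, hamiltonian (interaction A b) x
      - ∑ p, (block b p).card * Lstar (magnetization b x p) ≤ c) :
    (ising (interaction A b)).toMeasure.real E ≤ (N + 1 : ℝ) ^ k * Real.exp c := by
  classical
  set V := Finset.univ.image (magnetization b) with hV
  have hVc : ∀ v ∈ V, v ∈ cube k := by
    intro v hv
    obtain ⟨x, -, rfl⟩ := Finset.mem_image.1 hv
    exact magnetization_mem_cube b x
  have hx : ∀ x, E.indicator
      (fun x => Real.exp (hamiltonian (interaction A b) x) / partitionFn (interaction A b)) x
      ≤ Real.exp c * ∑ v ∈ V, tiltedWeight b v x := by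
    intro x
    have hn : ∀ v ∈ V, 0 ≤ tiltedWeight b v x := fun v hv => tiltedWeight_nonneg b (hVc v hv) x
    by_cases hxE : x ∈ E
    · rw [Set.indicator_of_mem hxE]
      -- Bounding by the sum over all of `V` removes the dependence of the tilt on `x`; each tilted
      -- weight then has total mass `1`.
      calc Real.exp (hamiltonian (interaction A b) x) / partitionFn (interaction A b)
          ≤ Real.exp (hamiltonian (interaction A b) x) / 2 ^ N := by
            gcongr
            exact two_pow_le_partitionFn b hA
        _ = Real.exp (hamiltonian (interaction A b) x
              - ∑ p, (block b p).card * Lstar (magnetization b x p))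
            * tiltedWeight b (magnetization b x) x := by
            rw [tiltedWeight_magnetization, ← mul_div_assoc, ← Real.exp_add, sub_add_cancel]
        _ ≤ Real.exp c * ∑ v ∈ V, tiltedWeight b v x := by
            have hm : magnetization b x ∈ V := Finset.mem_image_of_mem _ (Finset.mem_univ x)
            refine mul_le_mul (Real.exp_le_exp.2 (hE x hxE)) ?_ (hn _ hm) (Real.exp_pos _).le
            exact Finset.single_le_sum (f := fun v : EuclideanSpace ℝ (Fin k) =>
              tiltedWeight b v x) hn hm
    · rw [Set.indicator_of_notMem hxE]
      exact mul_nonneg (Real.exp_pos _).le (Finset.sum_nonneg hn)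
  rw [ising_real_apply]
  refine (Finset.sum_le_sum fun x _ => hx x).trans ?_
  rw [← Finset.mul_sum, Finset.sum_comm]
  simp only [sum_tiltedWeight, Finset.sum_const, nsmul_eq_mul, mul_one]
  rw [mul_comm]
  gcongr
  exact_mod_cast card_image_magnetization_le b

end Finite

/-! ### Passage to the limit of the block proportions. -/

section Asymptotic

variable {k : ℕ} {A : Matrix (Fin k) (Fin k) ℝ} {γ : Fin k → ℝ}

/-- Comparison of the exponent at block proportions `g` with the limiting functional. -/
theorem exponent_le_functional_add (g : Fin k → ℝ) {m : EuclideanSpace ℝ (Fin k)}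
    (hm : m ∈ cube k) :
    (1 / 2) * ∑ p, ∑ q, A p q * (g p * g q) * (m p * m q) - ∑ p, g p * Lstar (m p)
      ≤ functional A γ m + ((1 / 2) * ∑ p, ∑ q, |A p q| * |g p * g q - γ p ^ 2 * γ q ^ 2|
        + ∑ p, |g p - γ p ^ 2|) := by
  have hm1 : ∀ p, |m p| ≤ 1 := fun p => abs_le.2 (hm p)
  have h1 : ∑ p, ∑ q, A p q * (g p * g q) * (m p * m q)
      ≤ ∑ p, ∑ q, A p q * (γ p ^ 2 * γ q ^ 2) * (m p * m q)
        + ∑ p, ∑ q, |A p q| * |g p * g q - γ p ^ 2 * γ q ^ 2| := by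
    rw [← Finset.sum_add_distrib]
    refine Finset.sum_le_sum fun p _ => ?_
    rw [← Finset.sum_add_distrib]
    refine Finset.sum_le_sum fun q _ => ?_
    rw [← sub_le_iff_le_add', ← sub_mul, ← mul_sub]
    refine (le_abs_self _).trans ?_
    rw [abs_mul, abs_mul, abs_mul]
    exact mul_le_of_le_one_right (by positivity)
      (mul_le_one₀ (hm1 p) (abs_nonneg _) (hm1 q))
  have h2 : ∑ p, γ p ^ 2 * Lstar (m p) ≤ ∑ p, g p * Lstar (m p) + ∑ p, |g p - γ p ^ 2| := by
    rw [← Finset.sum_add_distrib]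
    refine Finset.sum_le_sum fun p _ => ?_
    rw [← sub_le_iff_le_add', ← sub_mul]
    refine (le_abs_self _).trans ?_
    rw [abs_mul, abs_sub_comm, abs_of_nonneg (Lstar_nonneg (hm p))]
    exact mul_le_of_le_one_right (abs_nonneg _) (Lstar_le_one (hm p))
  rw [functional_eq]
  linarith

theorem exists_functional_le_neg (hγ : ∀ i, 0 < γ i)
    (hhigh : ‖Matrix.toEuclideanCLM (n := Fin k) (𝕜 := ℝ)
      (Matrix.diagonal γ * A * Matrix.diagonal γ)‖ ≤ 1) {ε : ℝ} (hε : 0 < ε) :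
    ∃ δ > 0, ∀ x ∈ cube k, ε ≤ ‖x‖ → functional A γ x ≤ -δ := by
  obtain ⟨c, hc, hcγ⟩ : ∃ c > 0, ∀ i, c ≤ γ i ^ 2 := by
    rcases isEmpty_or_nonempty (Fin k) with h | h
    · exact ⟨1, one_pos, fun i => h.elim i⟩
    · obtain ⟨i, hi⟩ := Finite.exists_min fun i => γ i ^ 2
      exact ⟨γ i ^ 2, pow_pos (hγ i) 2, hi⟩
  -- From `(∑ xᵢ²)² ≤ k ∑ xᵢ⁴`; using `k + 1` keeps the denominator nonzero when `k = 0`.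
  refine ⟨c * (ε ^ 4 / (12 * (k + 1))), by positivity, fun x hx hxε => ?_⟩
  refine (functional_le hhigh hx).trans (neg_le_neg ?_)
  have h1 : c * (∑ i, x i ^ 4 / 12) ≤ ∑ i, γ i ^ 2 * (x i ^ 4 / 12) := by
    rw [Finset.mul_sum]
    exact Finset.sum_le_sum fun i _ => mul_le_mul_of_nonneg_right (hcγ i) (by positivity)
  refine le_trans (mul_le_mul_of_nonneg_left ?_ hc.le) h1
  have h2 : (∑ i, x i ^ 2) ^ 2 ≤ k * ∑ i, x i ^ 4 := by
    have := sq_sum_le_card_mul_sum_sq (s := Finset.univ) (f := fun i => x i ^ 2)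
    simpa [← pow_mul] using this
  have h3 : ‖x‖ ^ 2 = ∑ i, x i ^ 2 := by simp [EuclideanSpace.norm_sq_eq]
  have h4 : ε ^ 4 ≤ (∑ i, x i ^ 2) ^ 2 := by
    rw [← h3, ← pow_mul]
    exact pow_le_pow_left₀ hε.le hxε 4
  have h5 : 0 ≤ ∑ i, x i ^ 4 := Finset.sum_nonneg fun i _ => by positivity
  rw [← Finset.sum_div, div_le_div_iff₀ (by positivity) (by norm_num)]
  nlinarith

theorem eventually_pow_mul_exp_le {δ : ℝ} (hδ : 0 < δ) (k : ℕ) :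
    ∀ᶠ n : ℕ in atTop, (n + 1 : ℝ) ^ k * Real.exp (-(n * δ)) ≤ Real.exp (-n * (δ / 2)) := by
  have h := (Real.tendsto_pow_mul_exp_neg_atTop_nhds_zero k)
  have ht : Tendsto (fun n : ℕ => (n + 1 : ℝ) * (δ / 2)) atTop atTop :=
    (tendsto_natCast_atTop_atTop.atTop_add tendsto_const_nhds).atTop_mul_const (by positivity)
  -- This threshold cancels the factors `(δ/2)^k` and `exp(-δ/2)` arising from `((n+1)δ/2)^k
  -- exp(-(n+1)δ/2)`.
  have hlim := (h.comp ht).eventually (gt_mem_nhds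
    (show (0 : ℝ) < (δ / 2) ^ k * Real.exp (-(δ / 2)) by positivity))
  filter_upwards [hlim] with n hn
  simp only [Function.comp_apply, mul_pow] at hn
  have e1 : Real.exp (-((n + 1 : ℝ) * (δ / 2)))
      = Real.exp (-n * (δ / 2)) * Real.exp (-(δ / 2)) := by
    rw [← Real.exp_add]; congr 1; ring
  have e2 : Real.exp (-(n * δ)) = Real.exp (-n * (δ / 2)) * Real.exp (-n * (δ / 2)) := by
    rw [← Real.exp_add]; congr 1; ring
  rw [e1] at hn
  have hpos : 0 < (δ / 2) ^ k * Real.exp (-(δ / 2)) := by positivity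
  have : (n + 1 : ℝ) ^ k * Real.exp (-n * (δ / 2)) ≤ 1 := by
    by_contra! hlt
    nlinarith
  rw [e2, ← mul_assoc]
  exact mul_le_of_le_one_left (Real.exp_pos _).le this

theorem exponential_concentration (hA : A.PosDef) {N : ℕ → ℕ} (hN : StrictMono N)
    (b : ∀ n, Fin (N n) → Fin k) (hγ : ∀ i, 0 < γ i)
    (hlim : ∀ i, Tendsto (fun n => Real.sqrt (((block (b n) i).card : ℝ) / (N n : ℝ)))
      atTop (𝓝 (γ i)))
    (hhigh : ‖Matrix.toEuclideanCLM (n := Fin k) (𝕜 := ℝ)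
      (Matrix.diagonal γ * A * Matrix.diagonal γ)‖ ≤ 1) {ε : ℝ} (hε : 0 < ε) :
    ∃ I : ℝ, 0 < I ∧ ∀ᶠ n in atTop, (ising (interaction A (b n))).toMeasure.real
      {x | ε ≤ ‖magnetization (b n) x‖} ≤ Real.exp (-(N n : ℝ) * I) := by
  obtain ⟨δ, hδ, hδle⟩ := exists_functional_le_neg (A := A) hγ hhigh hε
  have hg : ∀ i, Tendsto (fun n => ((block (b n) i).card : ℝ) / (N n : ℝ)) atTop
      (𝓝 (γ i ^ 2)) := by
    intro i
    refine ((hlim i).pow 2).congr fun n => ?_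
    exact Real.sq_sqrt (by positivity)
  have herr : Tendsto (fun n => (1 / 2) * ∑ p, ∑ q, |A p q| *
      |((block (b n) p).card : ℝ) / N n * (((block (b n) q).card : ℝ) / N n)
        - γ p ^ 2 * γ q ^ 2| + ∑ p, |((block (b n) p).card : ℝ) / N n - γ p ^ 2|)
      atTop (𝓝 0) := by
    have h0 : (0 : ℝ) = (1 / 2) * ∑ p, ∑ q, |A p q| *
      |γ p ^ 2 * γ q ^ 2 - γ p ^ 2 * γ q ^ 2| + ∑ p, |γ p ^ 2 - γ p ^ 2| := by simp
    rw [h0]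
    refine (Tendsto.const_mul _ (tendsto_finsetSum _ fun p _ => tendsto_finsetSum _ fun q _ =>
      Tendsto.const_mul _ ?_)).add (tendsto_finsetSum _ fun p _ => ?_)
    · exact (((hg p).mul (hg q)).sub_const _).abs
    · exact ((hg p).sub_const _).abs
  -- One halving pays for the error in the block proportions, the other for the factor `(N+1)^k`.
  refine ⟨δ / 2 / 2, by positivity, ?_⟩
  filter_upwards [herr.eventually (gt_mem_nhds (half_pos hδ)), hN.tendsto_atTop.eventually
    (eventually_pow_mul_exp_le (half_pos hδ) k),
    hN.tendsto_atTop.eventually (eventually_ge_atTop 1)] with n hn hexp hN1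
  have hN0 : (N n : ℝ) ≠ 0 := by
    have : N n ≠ 0 := by omega
    exact_mod_cast this
  refine (ising_real_le (b n) hA _ (-(N n * (δ / 2))) fun x hx => ?_).trans hexp
  have hc := magnetization_mem_cube (b n) x
  have h1 := exponent_le_functional_add (A := A) (γ := γ)
    (fun p => ((block (b n) p).card : ℝ) / N n) hc
  have h2 := hδle _ hc hx
  have h3 : ∑ p, (block (b n) p).card * Lstar (magnetization (b n) x p)
      = N n * ∑ p, ((block (b n) p).card : ℝ) / N n * Lstar (magnetization (b n) x p) := by
    rw [Finset.mul_sum]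
    refine Finset.sum_congr rfl fun p _ => ?_
    field_simp
  rw [hamiltonian_interaction_eq (b n) (by omega), h3, ← mul_sub, ← mul_neg]
  refine mul_le_mul_of_nonneg_left ?_ (Nat.cast_nonneg _)
  linarith

end Asymptotic

end BlockIsing

theorem corollary1p2 {k : ℕ} (A : Matrix (Fin k) (Fin k) ℝ) (hA : A.PosDef)
    (N : ℕ → ℕ) (hN : StrictMono N)
    (b : ∀ n, Fin (N n) → Fin k)
    (γ : Fin k → ℝ) (hγ : ∀ i, 0 < γ i)
    (hlim : ∀ i, Filter.Tendsto
      (fun n => Real.sqrt (((BlockIsing.block (b n) i).card : ℝ) / (N n : ℝ)))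
      Filter.atTop (nhds (γ i)))
    (hhigh : ‖Matrix.toEuclideanCLM (n := Fin k) (𝕜 := ℝ)
      (Matrix.diagonal γ * A * Matrix.diagonal γ)‖ ≤ 1) :
    -- exponential concentration of the normalized block magnetization at `0`
    (∀ ε : ℝ, 0 < ε → ∃ I : ℝ, 0 < I ∧ ∀ᶠ n in Filter.atTop,
      (BlockIsing.ising (BlockIsing.interaction A (b n))).toMeasure.real
          {x | ε ≤ ‖BlockIsing.magnetization (b n) x‖} ≤ Real.exp (-(N n : ℝ) * I)) ∧
    -- `0` is the unique critical point of the rate function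
    (∀ x ∈ BlockIsing.openCube k,
      HasGradientAt (BlockIsing.rate A γ) 0 x ↔ x = 0) ∧
    -- `0` is the unique interior local extremum of the rate function
    (∀ x ∈ BlockIsing.openCube k, IsLocalExtr (BlockIsing.rate A γ) x ↔ x = 0) ∧
    -- `0` is the unique local minimum of the rate function on the closed cube
    (∀ x ∈ BlockIsing.cube k,
      IsLocalMinOn (BlockIsing.rate A γ) (BlockIsing.cube k) x ↔ x = 0) ∧
    -- `0` is the unique zero and strict global minimum of the rate function
    BlockIsing.rate A γ 0 = 0 ∧
    (∀ x ∈ BlockIsing.cube k, x ≠ 0 → 0 < BlockIsing.rate A γ x) := by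
  exact ⟨fun _ hε => BlockIsing.exponential_concentration hA hN b hγ hlim hhigh hε,
    fun _ hx => BlockIsing.hasGradientAt_rate_iff hγ hhigh hx,
    fun _ hx => BlockIsing.isLocalExtr_rate_iff hγ hhigh hx,
    fun _ hx => BlockIsing.isLocalMinOn_rate_iff hγ hhigh hx,
    BlockIsing.rate_zero hhigh,
    fun _ hx h0 => BlockIsing.rate_pos hγ hhigh hx h0⟩
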